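/- **Theorem 4.1.** For a group $X$ acting trivially on $\mathbb C^\times$, let $Z^2(X,\mathbb C^\times)$ be the group of 2-cocycles, i.e. maps $\alpha:X\times X\to\mathbb C^\times$ with $\alpha(x,y)\alpha(xy,z)=\alpha(y,z)\alpha(x,yz)$ for all $x,y,z\in X$, and let $\mathrm H^2(X,\mathbb C^\times)$ be its quotient by the coboundaries $(x,y)\mapsto u(x)u(y)u(xy)^{-1}$ with $u:X\to\mathbb C^\times$. For $\alpha\in Z^2(X,\mathbb C^\times)$ the twisted group algebra $\mathbb C^\alpha X$ is the $\mathbb C$-algebra with basis $\{\bar x: x\in X\}$ and multiplication $\bar x\,\bar y=\alpha(x,y)\,\overline{xy}$. A finite group $X$ is of central type if $\mathbb C^\alpha X$ is a simple ring for some $\alpha\in Z^2(X,\mathbb C^\times)$. For a central subgroup $Z$ of a group $G$, the inflation $\inf:\mathrm H^2(G/Z,\mathbb C^\times)\to\mathrm H^2(G,\mathbb C^\times)$ sends $[\beta]$ to the class of $(x,y)\mapsto\beta(xZ,yZ)$, and the transgression $\mathrm{tra}:\mathrm{Hom}(Z,\mathbb C^\times)\to\mathrm H^2(G/Z,\mathbb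 C^\times)$ sends $\chi$ to the class of $(x,y)\mapsto\chi(\mu(x)\mu(y)\mu(xy)^{-1})$, where $\mu$ is a section of $G\to G/Z$ (the class does not depend on $\mu$). Let $p$ be a prime, let $G$ be a non-abelian group of order $p^5$, and let $Z\neq 1$ be a central subgroup of $G$ such that 1. $G/Z$ is not of central type and $|G/Z|\ge p^2$; 2. the sequence $1\to\mathrm{Hom}(Z,\mathbb C^\times)\xrightarrow{\mathrm{tra}}\mathrm H^2(G/Z,\mathbb C^\times)\xrightarrow{\inf}\mathrm H^2(G,\mathbb C^\times)\to 1$ is exact. Then for every $\alpha\in Z^2(G,\mathbb C^\times)$ whose class in $\mathrm H^2(G,\mathbb C^\times)$ is non-trivial there is an isomorphism of $\mathbb C$-algebras $$\mathbb C^\alpha G\;\cong\;\bigoplus_{i=1}^{p^3} M_p(\mathbb C).$$ -/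

import Mathlib

/-! ## Second cohomology with trivial coefficients

Mathlib's `groupCohomology.H2` needs the group and the coefficient ring in one universe and is
written additively, so the multiplicative groups of 2-cocycles, of 2-coboundaries and their
quotient are defined here for an arbitrary group `G` acting trivially on a commutative
group `M`. -/

/-- The group `Z²(G, M)` of (not necessarily normalized) 2-cocycles, for the trivial action. -/
def TwoCocycle (G M : Type*) [Group G] [CommGroup M] : Subgroup (G × G → M) where
  carrier := {f | ∀ x y z : G, f (x, y) * f (x * y, z) = f (y, z) * f (x, y * z)}
  mul_mem' := by
    intro a b ha hb x y z
    simp only [Pi.mul_apply]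
    rw [mul_mul_mul_comm, ha, hb, mul_mul_mul_comm]
  one_mem' := by intro x y z; simp
  inv_mem' := by
    intro a ha x y z
    simp only [Pi.inv_apply]
    rw [← mul_inv, ← mul_inv, ha]

/-- The coboundary of a function `u : G → M`, that is `(x, y) ↦ u x * u y * (u (x * y))⁻¹`. -/
def TwoCoboundaryMap (G M : Type*) [Group G] [CommGroup M] : (G → M) →* TwoCocycle G M where
  toFun u := ⟨fun q => u q.1 * u q.2 * (u (q.1 * q.2))⁻¹, by
    intro x y z
    simp only [mul_assoc x y z]
    generalize u (x * (y * z)) = a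
    generalize u (x * y) = b
    generalize u (y * z) = c
    calc u x * u y * b⁻¹ * (b * u z * a⁻¹) = u x * u y * u z * a⁻¹ := by group
      _ = u y * u z * u x * a⁻¹ := by rw [mul_assoc (u x), mul_comm (u x)]
      _ = u y * u z * c⁻¹ * (c * u x * a⁻¹) := by group
      _ = u y * u z * c⁻¹ * (u x * c * a⁻¹) := by rw [mul_comm c]⟩
  map_one' := by ext; simp
  map_mul' u v := by
    ext q
    simp only [Subgroup.coe_mul, Pi.mul_apply, mul_inv]
    ac_rfl

/-- The group `H²(G, M) = Z²(G, M) / B²(G, M)`, for the trivial action. -/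
abbrev SecondCohomology (G M : Type*) [Group G] [CommGroup M] : Type _ :=
  TwoCocycle G M ⧸ (TwoCoboundaryMap G M).range

/-- The homomorphism sending a 2-cocycle to its class in `H²(G, M)`. -/
def cohomologyClass {G M : Type*} [Group G] [CommGroup M] :
    TwoCocycle G M →* SecondCohomology G M :=
  QuotientGroup.mk' (TwoCoboundaryMap G M).range

/-! ## Inflation and transgression -/

/-- Inflation of 2-cocycles from `G / N` to `G`: `(x, y) ↦ β (xN, yN)`. -/
def inflationCocycle {G : Type*} (M : Type*) [Group G] [CommGroup M] (N : Subgroup G)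
    [N.Normal] : TwoCocycle (G ⧸ N) M →* TwoCocycle G M where
  toFun β := ⟨fun q => β.1 ((q.1 : G ⧸ N), (q.2 : G ⧸ N)), by
    intro x y z
    simpa using β.2 (x : G ⧸ N) (y : G ⧸ N) (z : G ⧸ N)⟩
  map_one' := rfl
  map_mul' _ _ := rfl

/-- The inflation homomorphism `H²(G / N, M) → H²(G, M)`. -/
def inflation {G : Type*} (M : Type*) [Group G] [CommGroup M] (N : Subgroup G)
    [N.Normal] : SecondCohomology (G ⧸ N) M →* SecondCohomology G M :=
  QuotientGroup.map _ _ (inflationCocycle M N) (by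
    rintro _ ⟨u, rfl⟩
    exact ⟨fun g => u (g : G ⧸ N), rfl⟩)

/-- For a section `s` of `G → G / Z`, the element `s x * s y * (s (x * y))⁻¹` of `Z`. -/
def sectionDefect {G : Type*} [Group G] (Z : Subgroup G) [Z.Normal] (s : G ⧸ Z → G)
    (hs : ∀ x, (s x : G ⧸ Z) = x) (x y : G ⧸ Z) : Z :=
  ⟨s x * s y * (s (x * y))⁻¹, by
    rw [← QuotientGroup.eq_one_iff]
    simp [hs]⟩

/-- For a central subgroup `Z` of `G` and a section `s` of `G → G / Z`, the homomorphism that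
sends `χ : Z → M` to the 2-cocycle `(x, y) ↦ χ (s x * s y * (s (x * y))⁻¹)` of `G / Z`. -/
def transgressionCocycle {G : Type*} (M : Type*) [Group G] [CommGroup M] (Z : Subgroup G)
    [Z.Normal] (hZ : Z ≤ Subgroup.center G) (s : G ⧸ Z → G) (hs : ∀ x, (s x : G ⧸ Z) = x) :
    (Z →* M) →* TwoCocycle (G ⧸ Z) M where
  toFun χ := ⟨fun q => χ (sectionDefect Z s hs q.1 q.2), by
    intro x y z
    have key : sectionDefect Z s hs x y * sectionDefect Z s hs (x * y) z =
        sectionDefect Z s hs y z * sectionDefect Z s hs x (y * z) := by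
      have hc := Subgroup.mem_center_iff.1 (hZ (sectionDefect Z s hs y z).2)
      apply Subtype.ext
      have h1 : ((sectionDefect Z s hs y z * sectionDefect Z s hs x (y * z) : Z) : G)
          = s x * (sectionDefect Z s hs y z : G) * s (y * z) * (s (x * (y * z)))⁻¹ := by
        rw [hc (s x)]
        simp [sectionDefect, mul_assoc]
      rw [h1]
      simp [sectionDefect, mul_assoc]
    simp only [← map_mul, key]⟩
  map_one' := rfl
  map_mul' _ _ := rfl

/-- The class of the transgression cocycle does not depend on the section. -/
theorem transgressionCocycle_class_eq {G : Type*} (M : Type*) [Group G] [CommGroup M]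
    (Z : Subgroup G) [Z.Normal] (hZ : Z ≤ Subgroup.center G) (s t : G ⧸ Z → G)
    (hs : ∀ x, (s x : G ⧸ Z) = x) (ht : ∀ x, (t x : G ⧸ Z) = x) (χ : Z →* M) :
    cohomologyClass (transgressionCocycle M Z hZ s hs χ) =
      cohomologyClass (transgressionCocycle M Z hZ t ht χ) := by
  have hd : ∀ x, t x * (s x)⁻¹ ∈ Z := fun x => by
    rw [← QuotientGroup.eq_one_iff]; simp [hs, ht]
  refine QuotientGroup.eq.2 (MonoidHom.mem_range.2 ⟨fun x => χ ⟨_, hd x⟩, ?_⟩)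
  refine eq_inv_mul_of_mul_eq (Subtype.ext (funext ?_))
  rintro ⟨x, y⟩
  change χ _ * (χ _ * χ _ * (χ _)⁻¹) = χ _
  rw [← map_inv, ← map_mul, ← map_mul, ← map_mul]
  congr 1
  apply Subtype.ext
  have cx := Subgroup.mem_center_iff.1 (hZ (hd x))
  have cy := Subgroup.mem_center_iff.1 (hZ (hd y))
  change s x * s y * (s (x * y))⁻¹ *
    ((t x * (s x)⁻¹) * (t y * (s y)⁻¹) * (t (x * y) * (s (x * y))⁻¹)⁻¹) =
      t x * t y * (t (x * y))⁻¹
  have e1 : t x = (t x * (s x)⁻¹) * s x := by simp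
  have e2 : t y = (t y * (s y)⁻¹) * s y := by simp
  conv_rhs => rw [e1, e2]
  generalize t x * (s x)⁻¹ = a at *
  generalize t y * (s y)⁻¹ = b at *
  have e3 : (t (x * y) * (s (x * y))⁻¹)⁻¹ * (s (x * y))⁻¹ = (t (x * y))⁻¹ * 1 := by
    have := Subgroup.mem_center_iff.1 (hZ (Z.inv_mem (hd (x * y)))) ((s (x * y))⁻¹)
    rw [← this]; group
  have c3 := Subgroup.mem_center_iff.1 (hZ (Z.inv_mem (hd (x * y))))
  generalize (t (x * y) * (s (x * y))⁻¹)⁻¹ = c at *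
  rw [mul_one] at e3
  rw [← e3, ← c3]
  calc s x * s y * (s (x * y))⁻¹ * (a * b * c)
      = (s x * s y * (s (x * y))⁻¹ * a) * b * c := by group
    _ = a * (s x * s y * (s (x * y))⁻¹ * b) * c := by rw [cx]; group
    _ = a * (b * s x) * s y * (s (x * y))⁻¹ * c := by rw [cy]; group
    _ = a * s x * (b * s y) * ((s (x * y))⁻¹ * c) := by rw [← cy]; group

/-- The transgression homomorphism `Hom(Z, M) → H²(G / Z, M)` of the central extension
`1 → Z → G → G / Z → 1`. -/
noncomputable def transgression {G : Type*} (M : Type*) [Group G] [CommGroup M]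
    (Z : Subgroup G) [Z.Normal] (hZ : Z ≤ Subgroup.center G) :
    (Z →* M) →* SecondCohomology (G ⧸ Z) M :=
  cohomologyClass.comp
    (transgressionCocycle M Z hZ Quotient.out (fun x => QuotientGroup.out_eq' x))

/-! ## Twisted group algebras -/

/-- The twisted group algebra `R^α G`: the free `R`-module with a basis `ḡ`, `g ∈ G`. The
multiplication given by `ḡ * h̄ = α (g, h) • (gh)̄ ` is defined below. -/
def TwistedGroupAlgebra {G R : Type*} [Group G] [CommRing R] (_α : TwoCocycle G Rˣ) : Type _ :=
  G →₀ R

namespace TwistedGroupAlgebra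

variable {G R : Type*} [Group G] [CommRing R] (α : TwoCocycle G Rˣ)

noncomputable instance : AddCommGroup (TwistedGroupAlgebra α) :=
  inferInstanceAs (AddCommGroup (G →₀ R))

noncomputable instance : Module R (TwistedGroupAlgebra α) :=
  inferInstanceAs (Module R (G →₀ R))

/-- The distinguished basis `g ↦ ḡ`. -/
noncomputable def basis : Module.Basis G R (TwistedGroupAlgebra α) :=
  Module.Basis.ofRepr (LinearEquiv.refl R (G →₀ R))

/-- The `R`-bilinear multiplication with `ḡ * h̄ = α (g, h) • (gh)̄ `. -/
noncomputable def mulMap : TwistedGroupAlgebra α →ₗ[R] TwistedGroupAlgebra α →ₗ[R]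
    TwistedGroupAlgebra α :=
  (basis α).constr R fun g => (basis α).constr R fun h => (α.1 (g, h) : R) • basis α (g * h)

noncomputable instance : Mul (TwistedGroupAlgebra α) := ⟨fun x y => mulMap α x y⟩

/-- The identity element is `α (1, 1)⁻¹ • 1̄`. -/
noncomputable instance : One (TwistedGroupAlgebra α) :=
  ⟨(((α.1 (1, 1))⁻¹ : Rˣ) : R) • basis α 1⟩

theorem mul_def (x y : TwistedGroupAlgebra α) : x * y = mulMap α x y := rfl

theorem one_def :
    (1 : TwistedGroupAlgebra α) = (((α.1 (1, 1))⁻¹ : Rˣ) : R) • basis α 1 := rfl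

theorem basis_mul_basis (g h : G) :
    basis α g * basis α h = (α.1 (g, h) : R) • basis α (g * h) := by
  simp only [mul_def, mulMap, Module.Basis.constr_basis]

theorem smul_mul' (r : R) (x y : TwistedGroupAlgebra α) :
    (r • x) * y = r • (x * y) := by simp only [mul_def, map_smul, LinearMap.smul_apply]

theorem mul_smul' (r : R) (x y : TwistedGroupAlgebra α) :
    x * (r • y) = r • (x * y) := by simp only [mul_def, map_smul]

theorem induction {P : TwistedGroupAlgebra α → Prop} (x : TwistedGroupAlgebra α) (h0 : P 0)
    (hadd : ∀ x y, P x → P y → P (x + y)) (hs : ∀ g (a : R), P (a • basis α g)) : P x := by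
  have hx := (basis α).mem_span x
  induction hx using Submodule.span_induction with
  | mem x h => obtain ⟨g, rfl⟩ := h; simpa using hs g 1
  | zero => exact h0
  | add x y _ _ hx hy => exact hadd x y hx hy
  | smul a x h _ =>
    rw [← (basis α).linearCombination_repr (a • x), Finsupp.linearCombination_apply]
    exact Finset.sum_induction _ P hadd h0 fun g _ => hs g _

theorem map_one_fst (g : G) : α.1 (1, g) = α.1 (1, 1) := by
  have := α.2 1 1 g
  simpa using this.symm

theorem map_one_snd (g : G) : α.1 (g, 1) = α.1 (1, 1) := by
  have := α.2 g 1 1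
  simpa using this

theorem left_distrib' (x y z : TwistedGroupAlgebra α) :
    x * (y + z) = x * y + x * z := by simp only [mul_def, map_add]

theorem right_distrib' (x y z : TwistedGroupAlgebra α) :
    (x + y) * z = x * z + y * z := by simp only [mul_def, map_add, LinearMap.add_apply]

theorem zero_mul' (x : TwistedGroupAlgebra α) : 0 * x = 0 := by
  simp only [mul_def, map_zero, LinearMap.zero_apply]

theorem mul_zero' (x : TwistedGroupAlgebra α) : x * 0 = 0 := by
  simp only [mul_def, map_zero]

noncomputable instance : Ring (TwistedGroupAlgebra α) where
  __ := (inferInstance : AddCommGroup (TwistedGroupAlgebra α))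
  left_distrib := left_distrib' α
  right_distrib := right_distrib' α
  zero_mul := zero_mul' α
  mul_zero := mul_zero' α
  mul_assoc x y z := by
    induction x using TwistedGroupAlgebra.induction with
    | h0 => simp only [zero_mul']
    | hadd x x' hx hx' => simp only [right_distrib', hx, hx']
    | hs g a =>
      induction y using TwistedGroupAlgebra.induction with
      | h0 => simp only [zero_mul', mul_zero']
      | hadd y y' hy hy' => simp only [right_distrib', left_distrib', hy, hy']
      | hs h b =>
        induction z using TwistedGroupAlgebra.induction with
        | h0 => simp only [mul_zero']
        | hadd z z' hz hz' => simp only [left_distrib', hz, hz']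
        | hs k c =>
          have h1 := congrArg Units.val (α.2 g h k)
          simp only [Units.val_mul] at h1
          simp only [smul_mul', mul_smul', basis_mul_basis, smul_smul, mul_assoc g h k]
          congr 1
          linear_combination (a * b * c) * h1
  one_mul x := by
    induction x using TwistedGroupAlgebra.induction with
    | h0 => exact mul_zero' α _
    | hadd x y hx hy => rw [left_distrib', hx, hy]
    | hs g a =>
      rw [one_def, smul_mul', mul_smul', basis_mul_basis, map_one_fst α g, one_mul, smul_comm a,
        smul_smul, Units.inv_mul, one_smul]
  mul_one x := by
    induction x using TwistedGroupAlgebra.induction with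
    | h0 => exact zero_mul' α _
    | hadd x y hx hy => rw [right_distrib', hx, hy]
    | hs g a =>
      rw [one_def, smul_mul', mul_smul', basis_mul_basis, map_one_snd α g, mul_one,
        smul_smul _ _ (basis α g), Units.inv_mul, one_smul]

noncomputable instance : Algebra R (TwistedGroupAlgebra α) :=
  Algebra.ofModule (smul_mul' α) (fun r x y => mul_smul' α r x y)

end TwistedGroupAlgebra

/-- A (finite) group `G` is of central type if the complex twisted group algebra `ℂ^α G` is
simple for some 2-cocycle `α` of `G` with values in `ℂˣ`. -/
def IsCentralType (G : Type*) [Group G] : Prop :=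
  ∃ α : TwoCocycle G ℂˣ, IsSimpleRing (TwistedGroupAlgebra α)

/-! By Maschke's theorem `ℂ^α G` is a product of matrix algebras over `ℂ`, so the point is that
every block has size `p`; comparing dimensions, `p ^ 5 = n * p ^ 2`, then gives the number of
blocks.

A block of size `d` is an irreducible projective representation of `G`, encoded by matrices spanning
the full matrix algebra. Since inflation is surjective, `α` is cohomologous to a cocycle lifted from
`G / Z`; hence `Z` acts by scalars and the representation descends to `G / Z`, of order `p ^ m` with
`m ≤ 4` as `Z ≠ 1`. There `d` divides the order (`degree_dvd_card_of_span_eq_top`), so `d = p ^ k`.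
A dimension count gives `d ^ 2 ≤ p ^ m`, and equality would make `G / Z` of central type. Finally `d
≠ 1` because `α` is not a coboundary. So `0 < 2 * k < m ≤ 4`, which forces `k = 1`. -/

open Subgroup
open scoped commutatorElement

/-! ### Finiteness and integrality of commutators -/

/-- The full preimage in `H` of the image of a homomorphism to `H` modulo its center has only
finitely many commutators if the source is finite. -/
theorem finite_commutator_comap_mk_range {X H : Type*} [Group X] [Finite X] [Group H]
    (f : X →* H ⧸ center H) :
    Finite (_root_.commutator (f.range.comap (QuotientGroup.mk' (center H)))) := by
  set Γ := f.range.comap (QuotientGroup.mk' (center H)) with hΓ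
  choose r hr using fun x => QuotientGroup.mk'_surjective (center H) (f x)
  have hrΓ (x : X) : r x ∈ Γ := ⟨x, (hr x).symm⟩
  -- A commutator depends only on the classes of its entries modulo the center, so pairs from `X`
  -- already give all of them.
  have : Finite (commutatorSet Γ) := by
    refine Set.Finite.subset (Set.finite_range
      fun q : X × X => ⁅(⟨r q.1, hrΓ q.1⟩ : Γ), (⟨r q.2, hrΓ q.2⟩ : Γ)⁆) ?_
    rintro _ ⟨⟨g, x, hx⟩, ⟨h, y, hy⟩, rfl⟩
    refine ⟨(x, y), Subtype.ext ?_⟩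
    obtain ⟨a, ha, rfl⟩ : ∃ a ∈ center H, a * r x = g :=
      ⟨g * (r x)⁻¹, by
        rw [← QuotientGroup.ker_mk' (center H), MonoidHom.mem_ker, map_mul, map_inv, hr, ← hx,
          mul_inv_cancel], by simp⟩
    obtain ⟨b, hb, rfl⟩ : ∃ b ∈ center H, b * r y = h :=
      ⟨h * (r y)⁻¹, by
        rw [← QuotientGroup.ker_mk' (center H), MonoidHom.mem_ker, map_mul, map_inv, hr, ← hy,
          mul_inv_cancel], by simp⟩
    change r x * r y * (r x)⁻¹ * (r y)⁻¹ = a * r x * (b * r y) * (a * r x)⁻¹ * (b * r y)⁻¹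
    have hb' := mem_center_iff.1 hb
    calc r x * r y * (r x)⁻¹ * (r y)⁻¹
      _ = (r x * r y * (r x)⁻¹ * a * a⁻¹) * (r y)⁻¹ * b * b⁻¹ := by group
      _ = a * r x * (b * r y) * (a * r x)⁻¹ * (b * r y)⁻¹ := by
        rw [mem_center_iff.1 ha, mem_center_iff.1 hb]
        have h1 : b * (a * (r x * r y * (r x)⁻¹) * a⁻¹ * (r y)⁻¹) * b⁻¹ =
          (b * a * r x) * r y * (r x)⁻¹ * a⁻¹ * (r y)⁻¹ * b⁻¹ := by group
        have h2 : b * a * r x = a * r x * b := by rw [mul_assoc, ← hb']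
        rw [h1, h2]
        group
  -- Schur: a group with finitely many commutators has finite derived subgroup.
  infer_instance

/-- An element of the additive subgroup generated by a finite group of units is integral over `ℤ`. -/
theorem isIntegral_of_mem_span_subgroup {A : Type*} [Ring A] (K : Subgroup Aˣ) [Finite K]
    {a : A} (ha : a ∈ Submodule.span ℤ (Units.val '' (K : Set Aˣ))) : IsIntegral ℤ a := by
  have hS : ((K.toSubmonoid.map (Units.coeHom A) : Submonoid A) : Set A) =
      Units.val '' (K : Set Aˣ) := rfl
  -- The span of a group is closed under products, so the ring it generates is a finitely generated
  -- `ℤ`-module.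
  have key : Subalgebra.toSubmodule (Algebra.adjoin ℤ (Units.val '' (K : Set Aˣ))) =
      Submodule.span ℤ (Units.val '' (K : Set Aˣ)) := by
    rw [Algebra.adjoin_eq_span, ← hS, Submonoid.closure_eq]
  refine IsIntegral.of_mem_of_fg (Algebra.adjoin ℤ (Units.val '' (K : Set Aˣ))) ?_ a ?_
  · rw [key]
    exact Submodule.fg_span ((Set.toFinite (K : Set Aˣ)).image _)
  · rw [← Subalgebra.mem_toSubmodule, key]
    exact ha

/-! ### The degree of an irreducible projective representation divides the group order -/

section ProjectiveRepresentation

variable {K X : Type*} [Field K] [Group X] {d : ℕ}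

theorem Matrix.conj_eq_of_mk_eq {g h : (Matrix (Fin d) (Fin d) K)ˣ}
    (hgh : QuotientGroup.mk' (center (Matrix (Fin d) (Fin d) K)ˣ) g =
      QuotientGroup.mk' (center _) h) (T : Matrix (Fin d) (Fin d) K) :
    g.val * T * g⁻¹.val = h.val * T * h⁻¹.val := by
  obtain ⟨z, hz, rfl⟩ := (QuotientGroup.mk'_eq_mk' _).1 hgh
  obtain ⟨c, hc⟩ := Matrix.GeneralLinearGroup.mem_center_iff_val_mem_range_scalar.1 hz
  have h1 : z.val * T = T * z.val := by
    rw [← hc]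
    exact (Matrix.scalar_commute c (Commute.all c) T).eq
  rw [_root_.mul_inv_rev, Units.val_mul, Units.val_mul]
  calc g.val * T * g⁻¹.val = g.val * (T * z.val * z⁻¹.val) * g⁻¹.val := by
        rw [mul_assoc T, Units.mul_inv, mul_one]
    _ = g.val * z.val * T * (z⁻¹.val * g⁻¹.val) := by
        rw [← h1]
        simp only [mul_assoc]

/-- This replaces Schur's lemma, with irreducibility expressed as spanning the matrix algebra. -/
theorem Matrix.exists_smul_one_of_commute_span {S : Set (Matrix (Fin d) (Fin d) K)}
    (hS : Submodule.span K S = ⊤) {T : Matrix (Fin d) (Fin d) K}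
    (hT : ∀ s ∈ S, Commute s T) : ∃ c : K, T = c • 1 := by
  have h (s : Matrix (Fin d) (Fin d) K) : Commute s T := by
    have hs : s ∈ Submodule.span K S := hS ▸ Submodule.mem_top
    induction hs using Submodule.span_induction with
    | mem x hx => exact hT x hx
    | zero => exact Commute.zero_left _
    | add x y _ _ hx hy => exact hx.add_left hy
    | smul a x _ hx => exact hx.smul_left a
  obtain ⟨c, rfl⟩ := Matrix.mem_range_scalar_iff_commute_single'.2 fun i j => h _
  exact ⟨c, by rw [Matrix.smul_one_eq_diagonal]; rfl⟩

variable [Fintype X] [CharZero K] (f : X →* (Matrix (Fin d) (Fin d) K)ˣ ⧸ center (Matrix (Fin d) (Fin d) K)ˣ) (r : X → (Matrix (Fin d) (Fin d) K)ˣ)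
  (hr : ∀ x, QuotientGroup.mk' (center (Matrix (Fin d) (Fin d) K)ˣ) (r x) = f x)
  (hspan : Submodule.span K (Set.range fun x => (r x).val) = ⊤)

-- Conjugation ignores scalars, so translation by `y` permutes the summands. The sum therefore
-- commutes with every `r y` and is scalar; its trace determines the scalar.
include hr hspan in
theorem sum_conj_eq_trace_smul_one [NeZero d] (T : Matrix (Fin d) (Fin d) K) :
    ∑ x, (r x).val * T * (r x)⁻¹.val =
      ((Fintype.card X : K) / d * T.trace) • (1 : Matrix (Fin d) (Fin d) K) := by
  obtain ⟨c, hc⟩ : ∃ c : K, ∑ x, (r x).val * T *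
      (r x)⁻¹.val = c • 1 := by
    refine Matrix.exists_smul_one_of_commute_span hspan ?_
    rintro _ ⟨y, rfl⟩
    change _ * _ = _ * _
    dsimp only
    rw [← Units.mul_inv_eq_iff_eq_mul, Finset.mul_sum, Finset.sum_mul]
    refine Fintype.sum_equiv (Equiv.mulLeft y) _ _ fun x => ?_
    have h := Matrix.conj_eq_of_mk_eq (g := r y * r x) (h := r (y * x))
      (by simp only [map_mul, hr]) T
    rw [Equiv.coe_mulLeft, ← h, mul_inv_rev, Units.val_mul, Units.val_mul]
    simp only [mul_assoc]
  have htr := congrArg Matrix.trace hc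
  have hconj (x : X) : ((r x).val * T *
      (r x)⁻¹.val).trace = T.trace := by
    rw [Matrix.trace_mul_comm, ← mul_assoc, Units.inv_mul, one_mul]
  rw [Matrix.trace_sum, Finset.sum_congr rfl fun x _ => hconj x] at htr
  simp only [Finset.sum_const, Finset.card_univ, nsmul_eq_mul, Matrix.trace_smul,
    Matrix.trace_one, Fintype.card_fin, smul_eq_mul] at htr
  rw [hc, div_mul_eq_mul_div, htr, mul_div_cancel_right₀ _ (NeZero.ne _)]

-- Averaging `T = r y` turns the inner sum into a multiple of `tr (r y) • (r y)⁻¹`. Averaging the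
-- matrix units `E_ik` (a form of Schur orthogonality) evaluates the remaining sum over `y`.
include hr hspan in
theorem sum_sum_commutator_eq [NeZero d] :
    ∑ y, ∑ x, ⁅r x, r y⁆.val =
      ((Fintype.card X : K) / d) ^ 2 • (1 : Matrix (Fin d) (Fin d) K) := by
  have h1 (y : X) : ∑ x, ⁅r x, r y⁆.val =
      ((Fintype.card X : K) / d) • ((r y).val.trace •
        (r y)⁻¹.val) := by
    have h := congrArg (· * (r y)⁻¹.val)
      (sum_conj_eq_trace_smul_one f r hr hspan (r y))
    simp only [Finset.sum_mul, smul_mul_assoc, one_mul] at h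
    rw [smul_smul, ← h]
    rfl
  rw [Finset.sum_congr rfl fun y _ => h1 y, ← Finset.smul_sum, sq, mul_smul]
  congr 1
  ext k l
  have h2 (i : Fin d) := congrFun (congrFun
    (sum_conj_eq_trace_smul_one f r hr hspan (Matrix.single i k 1)) i) l
  have h3 (i : Fin d) (x : X) : ((r x).val * Matrix.single i k 1 * (r x)⁻¹.val :
      Matrix (Fin d) (Fin d) K) i l = ((r x).val : Matrix (Fin d) (Fin d) K) i i *
        ((r x)⁻¹.val : Matrix (Fin d) (Fin d) K) k l := by
    rw [Matrix.mul_assoc, Matrix.mul_apply, Finset.sum_eq_single i]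
    · simp
    · intro j _ hj
      simp [hj]
    · simp
  simp only [Matrix.sum_apply, h3] at h2
  simp only [Matrix.sum_apply, Matrix.smul_apply, Matrix.trace, Matrix.diag, smul_eq_mul,
    Finset.sum_mul]
  rw [Finset.sum_comm, Finset.sum_congr rfl fun i _ => h2 i, Finset.sum_eq_single k]
  · simp [Matrix.trace_single_eq_same]
  · intro i _ hi
    simp [Matrix.trace_single_eq_of_ne _ _ _ hi]
  · simp

include hr hspan in
/-- The degree of an irreducible complex projective representation divides the group order. -/
theorem degree_dvd_card_of_span_eq_top [NeZero d] : d ∣ Fintype.card X := by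
  set Γ := f.range.comap (QuotientGroup.mk' (center (Matrix (Fin d) (Fin d) K)ˣ))
  have := finite_commutator_comap_mk_range f
  -- The `r x` may generate an infinite group, but their commutators lie in this finite one.
  let D := (_root_.commutator Γ).map Γ.subtype
  have : Finite D := Set.Finite.image Γ.subtype (Set.toFinite (_root_.commutator Γ : Set Γ))
  have hrΓ (x : X) : r x ∈ Γ := ⟨x, (hr x).symm⟩
  have hD (a b : Γ) : ⁅(a : (Matrix (Fin d) (Fin d) K)ˣ), (b : (Matrix (Fin d) (Fin d) K)ˣ)⁆ ∈ D :=
    Subgroup.mem_map.2 ⟨⁅a, b⁆, Subgroup.commutator_mem_commutator (mem_top _) (mem_top _),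
      map_commutatorElement Γ.subtype a b⟩
  -- The double sum of commutators is integral and equals this scalar matrix.
  have hint : IsIntegral ℤ
      (algebraMap K (Matrix (Fin d) (Fin d) K) (((Fintype.card X : K) / d) ^ 2)) := by
    refine isIntegral_of_mem_span_subgroup D ?_
    rw [Algebra.algebraMap_eq_smul_one, ← sum_sum_commutator_eq f r hr hspan]
    refine Submodule.sum_mem _ fun y _ => Submodule.sum_mem _ fun x _ => Submodule.subset_span ?_
    exact ⟨_, hD ⟨r x, hrΓ x⟩ ⟨r y, hrΓ y⟩, rfl⟩
  rw [isIntegral_algebraMap_iff (FaithfulSMul.algebraMap_injective _ _)] at hint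
  have hQ : IsIntegral ℤ (((Fintype.card X : ℚ) / d) ^ 2) := by
    rw [← isIntegral_algebraMap_iff (FaithfulSMul.algebraMap_injective ℚ K)]
    simpa using hint
  obtain ⟨k, hk⟩ := IsIntegrallyClosed.isIntegral_iff.1 hQ
  have hdQ : (d : ℚ) ≠ 0 := NeZero.ne _
  rw [div_pow, eq_div_iff (pow_ne_zero 2 hdQ)] at hk
  have hZ : k * (d : ℤ) ^ 2 = (Fintype.card X : ℤ) ^ 2 := by
    rw [eq_intCast] at hk
    exact_mod_cast hk
  have : (d : ℤ) ^ 2 ∣ (Fintype.card X : ℤ) ^ 2 := ⟨k, by rw [← hZ, mul_comm]⟩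
  rw [Int.pow_dvd_pow_iff two_ne_zero] at this
  exact_mod_cast this

end ProjectiveRepresentation

/-! ### Semisimplicity and representations of twisted group algebras -/

namespace TwistedGroupAlgebra

section Field

variable {G : Type*} [Group G] (α : TwoCocycle G ℂˣ)

theorem basis_mul_basis_inv (g : G) :
    basis α g * basis α g⁻¹ = ((α.1 (g, g⁻¹) * α.1 (1, 1) : ℂˣ) : ℂ) • 1 := by
  rw [basis_mul_basis, one_def, smul_smul, ← Units.val_mul, mul_inv_cancel_right, mul_inv_cancel]

theorem isUnit_basis (g : G) : IsUnit (basis α g) := by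
  have key (g : G) : basis α g *
      ((((α.1 (g, g⁻¹) * α.1 (1, 1))⁻¹ : ℂˣ) : ℂ) • basis α g⁻¹) = 1 := by
    rw [mul_smul', basis_mul_basis_inv, smul_smul, ← Units.val_mul, inv_mul_cancel,
      Units.val_one, one_smul]
  obtain ⟨b, hb⟩ : ∃ b, b * basis α g = 1 := by
    refine ⟨(((α.1 (g⁻¹, g) * α.1 (1, 1))⁻¹ : ℂˣ) : ℂ) • basis α g⁻¹, ?_⟩
    have h := basis_mul_basis_inv α g⁻¹
    rw [inv_inv] at h
    rw [smul_mul', h, smul_smul, ← Units.val_mul, inv_mul_cancel, Units.val_one, one_smul]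
  exact isUnit_iff_exists_and_exists.2 ⟨⟨_, key g⟩, b, hb⟩

variable [Fintype G]

instance : FiniteDimensional ℂ (TwistedGroupAlgebra α) := (basis α).finiteDimensional_of_finite

theorem finrank_eq : Module.finrank ℂ (TwistedGroupAlgebra α) = Fintype.card G :=
  Module.finrank_eq_card_basis (basis α)

/-- Left multiplication by `ḡ` permutes the basis up to scalars, without fixed lines unless `g = 1`;
and `1̄` acts as the scalar `α (1, 1)`. -/
theorem trace_mulLeft (x : TwistedGroupAlgebra α) :
    LinearMap.trace ℂ _ (LinearMap.mulLeft ℂ x) =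
      (Fintype.card G * (α.1 (1, 1) : ℂ)) * (basis α).repr x 1 := by
  classical
  induction x using TwistedGroupAlgebra.induction with
  | h0 => simp
  | hadd x y hx hy =>
    have : LinearMap.mulLeft ℂ (x + y) = LinearMap.mulLeft ℂ x + LinearMap.mulLeft ℂ y := by
      ext; simp [add_mul]
    rw [this, map_add, hx, hy, map_add, Finsupp.add_apply, mul_add]
  | hs g a =>
    have : LinearMap.mulLeft ℂ (a • basis α g) = a • LinearMap.mulLeft ℂ (basis α g) := by
      ext; simp
    rw [this, map_smul, map_smul, Finsupp.smul_apply, smul_eq_mul, smul_eq_mul, mul_left_comm]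
    congr 1
    rw [LinearMap.trace_eq_matrix_trace ℂ (basis α), Matrix.trace]
    simp only [Matrix.diag, LinearMap.toMatrix_apply, LinearMap.mulLeft_apply, basis_mul_basis,
      map_smul, Module.Basis.repr_self, Finsupp.smul_apply, Finsupp.single_apply, mul_eq_right,
      smul_eq_mul]
    by_cases hg : g = 1
    · subst hg
      simp [map_one_fst]
    · simp [hg]

/-- **Maschke's theorem** for complex twisted group algebras. -/
instance : IsSemisimpleRing (TwistedGroupAlgebra α) := by
  have := IsArtinianRing.of_finite ℂ (TwistedGroupAlgebra α)
  rw [IsArtinianRing.isSemisimpleRing_iff_jacobson, eq_bot_iff]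
  intro x hx
  -- For `x` in the radical, `x * y` is nilpotent, so its trace, hence its coefficient at `1`,
  -- vanishes.
  have hnil (y : TwistedGroupAlgebra α) : (basis α).repr (x * y) 1 = 0 := by
    have hxy : x * y ∈ Ring.jacobson (TwistedGroupAlgebra α) := Ideal.mul_mem_right _ _ hx
    obtain ⟨n, hn⟩ := IsSemiprimaryRing.isNilpotent (R := TwistedGroupAlgebra α)
    have h0 : (x * y) ^ n = 0 := by
      have := Ideal.pow_mem_pow hxy n
      rwa [hn] at this
    have h1 : IsNilpotent (LinearMap.mulLeft ℂ (x * y)) := by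
      refine ⟨n, ?_⟩
      rw [LinearMap.pow_mulLeft, h0, LinearMap.mulLeft_zero_eq_zero]
    have h2 := (LinearMap.isNilpotent_trace_of_isNilpotent h1).eq_zero
    rw [trace_mulLeft] at h2
    simpa using h2
  rw [Ideal.mem_bot]
  refine (basis α).ext_elem fun g => ?_
  classical
  -- Multiplying by the basis element at `g⁻¹` moves the coefficient at `g` to `1`, up to a unit.
  have h3 (z : TwistedGroupAlgebra α) : (basis α).repr (z * basis α g⁻¹) 1 =
      (α.1 (g, g⁻¹) : ℂ) * (basis α).repr z g := by
    induction z using TwistedGroupAlgebra.induction with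
    | h0 => simp
    | hadd z w hz hw => simp [add_mul, hz, hw, mul_add]
    | hs h a =>
      by_cases hh : h = g
      · subst hh
        simp [basis_mul_basis, mul_comm]
      · have : h * g⁻¹ ≠ 1 := fun e => hh (mul_inv_eq_one.1 e)
        simp [basis_mul_basis, hh, this]
  have h4 := hnil (basis α g⁻¹)
  rw [h3] at h4
  simpa using h4

end Field

section Lift

variable {X A : Type*} [Group X] [Ring A] [Algebra ℂ A] (γ : TwoCocycle X ℂˣ) (r : X → Aˣ)
  (hr : ∀ x y, (r x * r y : A) = (γ.1 (x, y) : ℂ) • (r (x * y) : A))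

/-- The algebra homomorphism from a twisted group algebra given by units that multiply according
to the cocycle. -/
noncomputable def lift : TwistedGroupAlgebra γ →ₐ[ℂ] A :=
  AlgHom.ofLinearMap ((basis γ).constr ℂ fun x => (r x : A))
    (by
      rw [one_def, map_smul, Module.Basis.constr_basis]
      have h := hr 1 1
      rw [mul_one] at h
      have h2 : (r 1 : A) = (γ.1 (1, 1) : ℂ) • 1 := by
        rw [← (r 1).mul_left_inj, h, smul_mul_assoc, one_mul]
      rw [h2, smul_smul, Units.inv_mul, one_smul])
    (by
      intro a b
      induction a using TwistedGroupAlgebra.induction with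
      | h0 => simp
      | hadd a a' h h' => simp only [add_mul, map_add, h, h']
      | hs x s =>
        induction b using TwistedGroupAlgebra.induction with
        | h0 => simp
        | hadd b b' h h' => simp only [mul_add, map_add, h, h']
        | hs y t =>
          simp only [basis_mul_basis, map_smul, Module.Basis.constr_basis,
            smul_mul_assoc, mul_smul_comm, hr])

theorem lift_basis (x : X) : lift γ r hr (basis γ x) = r x := by
  simp [lift]

theorem lift_surjective (hspan : Submodule.span ℂ (Set.range fun x => (r x : A)) = ⊤) :
    Function.Surjective (lift γ r hr) := by
  rw [← AlgHom.coe_toLinearMap, ← LinearMap.range_eq_top, eq_top_iff, ← hspan, Submodule.span_le]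
  rintro _ ⟨x, rfl⟩
  exact ⟨basis γ x, lift_basis γ r hr x⟩

end Lift

end TwistedGroupAlgebra

/-! ### Projective representations as modules over twisted group algebras -/

section Units

variable {K : Type*} [Field K] {d : ℕ}

theorem Matrix.exists_eq_smul_of_mk_eq {g h : (Matrix (Fin d) (Fin d) K)ˣ}
    (hgh : QuotientGroup.mk' (center (Matrix (Fin d) (Fin d) K)ˣ) g =
      QuotientGroup.mk' (center _) h) : ∃ c : Kˣ, g.val = (c : K) • h.val := by
  obtain ⟨z, hz, rfl⟩ := (QuotientGroup.mk'_eq_mk' _).1 hgh.symm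
  obtain ⟨c, rfl⟩ : z ∈ (Matrix.GeneralLinearGroup.scalar (Fin d)).range :=
    Matrix.GeneralLinearGroup.center_eq_range_scalar (R := K) (n := Fin d) ▸ hz
  refine ⟨c, ?_⟩
  change h.val * Matrix.scalar (Fin d) (c : K) = _
  rw [Matrix.scalar_apply, ← Matrix.smul_one_eq_diagonal, mul_smul_comm, mul_one]

theorem Matrix.mem_center_units_of_val_eq_smul_one {g : (Matrix (Fin d) (Fin d) K)ˣ} {c : K}
    (h : g.val = c • 1) : g ∈ center (Matrix (Fin d) (Fin d) K)ˣ :=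
  mem_center_iff.2 fun k => Units.ext (by simp [h])

theorem Matrix.mk_eq_of_val_eq_smul {g h : (Matrix (Fin d) (Fin d) K)ˣ} {c : K}
    (hgh : g.val = c • h.val) :
    QuotientGroup.mk' (center (Matrix (Fin d) (Fin d) K)ˣ) h =
      QuotientGroup.mk' (center _) g := by
  refine (QuotientGroup.mk'_eq_mk' _).2
    ⟨h⁻¹ * g, mem_center_units_of_val_eq_smul_one (c := c) ?_, mul_inv_cancel_left _ _⟩
  rw [Units.val_mul, hgh, mul_smul_comm, Units.inv_mul]

end Units

section ProjectiveRepresentation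

variable {X : Type*} [Group X] {d : ℕ}
  (f : X →* (Matrix (Fin d) (Fin d) ℂ)ˣ ⧸ center (Matrix (Fin d) (Fin d) ℂ)ˣ)
  (r : X → (Matrix (Fin d) (Fin d) ℂ)ˣ)
  (hr : ∀ x, QuotientGroup.mk' (center (Matrix (Fin d) (Fin d) ℂ)ˣ) (r x) = f x)

include hr in
/-- The multiplication of matrices lifting a homomorphism to the projective linear group is
governed by a 2-cocycle. -/
theorem exists_twoCocycle_of_lift [NeZero d] : ∃ γ : TwoCocycle X ℂˣ, ∀ x y,
    (r x * r y : Matrix (Fin d) (Fin d) ℂ) = (γ.1 (x, y) : ℂ) • (r (x * y)).val := by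
  have h (x y : X) : ∃ c : ℂˣ,
      (r x * r y : Matrix (Fin d) (Fin d) ℂ) = (c : ℂ) • (r (x * y)).val := by
    obtain ⟨c, hc⟩ := Matrix.exists_eq_smul_of_mk_eq (g := r x * r y) (h := r (x * y))
      (by rw [map_mul, hr, hr, hr, map_mul])
    exact ⟨c, by rw [← hc, Units.val_mul]⟩
  choose γ hγ using h
  refine ⟨⟨fun q => γ q.1 q.2, fun x y z => Units.ext ?_⟩, hγ⟩
  -- Both sides are the triple product `r x * r y * r z`, bracketed in two ways.
  have h1 : ((γ x y * γ (x * y) z : ℂˣ) : ℂ) • (r (x * y * z)).val =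
      ((γ y z * γ x (y * z) : ℂˣ) : ℂ) • (r (x * y * z)).val := by
    rw [Units.val_mul, Units.val_mul, mul_smul, mul_smul, ← hγ, mul_assoc x y z, ← hγ,
      ← smul_mul_assoc, ← mul_smul_comm, ← hγ, ← hγ, mul_assoc]
  exact smul_left_injective ℂ (r (x * y * z)).ne_zero h1

variable [Fintype X]
  (hspan : Submodule.span ℂ (Set.range fun x => (r x : Matrix (Fin d) (Fin d) ℂ)) = ⊤)

-- The matrix algebra is a quotient of a twisted group algebra of dimension `|X|`.
include hr hspan in
theorem degree_sq_le_card [NeZero d] : d ^ 2 ≤ Fintype.card X := by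
  obtain ⟨γ, hγ⟩ := exists_twoCocycle_of_lift f r hr
  have h := LinearMap.finrank_le_finrank_of_surjective
    (TwistedGroupAlgebra.lift_surjective γ r hγ hspan)
  rw [TwistedGroupAlgebra.finrank_eq, Module.finrank_matrix] at h
  simpa [sq] using h

-- Equal dimensions make that quotient map an isomorphism, and matrix algebras are simple.
include hr hspan in
theorem isCentralType_of_card_eq_degree_sq [NeZero d] (hd : Fintype.card X = d ^ 2) :
    IsCentralType X := by
  obtain ⟨γ, hγ⟩ := exists_twoCocycle_of_lift f r hr
  have hs := TwistedGroupAlgebra.lift_surjective γ r hγ hspan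
  have hfin : Module.finrank ℂ (TwistedGroupAlgebra γ) =
      Module.finrank ℂ (Matrix (Fin d) (Fin d) ℂ) := by
    rw [TwistedGroupAlgebra.finrank_eq, Module.finrank_matrix, hd]
    simp [sq]
  have hi : Function.Injective (TwistedGroupAlgebra.lift γ r hγ) :=
    (LinearMap.injective_iff_surjective_of_finrank_eq_finrank
      (f := (TwistedGroupAlgebra.lift γ r hγ).toLinearMap) hfin).2 hs
  exact ⟨γ, IsSimpleRing.of_ringEquiv
    (AlgEquiv.ofBijective (TwistedGroupAlgebra.lift γ r hγ) ⟨hi, hs⟩).symm.toRingEquiv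
    inferInstance⟩

end ProjectiveRepresentation

/-! ### Descent to `G / Z` and the block size -/

namespace TwistedGroupAlgebra

variable {G : Type*} [Group G] {α : TwoCocycle G ℂˣ} {d : ℕ}
  (ρ : TwistedGroupAlgebra α →ₐ[ℂ] Matrix (Fin d) (Fin d) ℂ)

/-- The image of a basis element under a matrix representation, as a unit. -/
noncomputable def basisImage (g : G) : (Matrix (Fin d) (Fin d) ℂ)ˣ :=
  ((isUnit_basis α g).map ρ).unit

theorem val_basisImage (g : G) : (basisImage ρ g).val = ρ (basis α g) := rfl

theorem basisImage_mul (g h : G) : (basisImage ρ g * basisImage ρ h).val =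
    (α.1 (g, h) : ℂ) • (basisImage ρ (g * h)).val := by
  rw [Units.val_mul, val_basisImage, val_basisImage, val_basisImage, ← map_mul, basis_mul_basis,
    map_smul]

theorem span_basisImage (hρ : Function.Surjective ρ) :
    Submodule.span ℂ (Set.range fun g => (basisImage ρ g).val) = ⊤ := by
  have : (Set.range fun g => (basisImage ρ g).val) = ρ.toLinearMap '' Set.range (basis α) := by
    rw [← Set.range_comp]
    rfl
  rw [this, Submodule.span_image, (basis α).span_eq, Submodule.map_top]
  exact LinearMap.range_eq_top.2 hρ

/-- The homomorphism to the projective linear group defined by a matrix representation of a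
twisted group algebra. -/
noncomputable def projectiveHom :
    G →* (Matrix (Fin d) (Fin d) ℂ)ˣ ⧸ center (Matrix (Fin d) (Fin d) ℂ)ˣ :=
  MonoidHom.mk' (fun g => QuotientGroup.mk' _ (basisImage ρ g)) fun g h => by
    rw [← map_mul]
    exact Matrix.mk_eq_of_val_eq_smul (basisImage_mul ρ g h)

/-- In degree one, the determinants of the images of the basis form a function whose coboundary is
`α`. -/
theorem degree_ne_one (hα : cohomologyClass α ≠ 1)
    (ρ : TwistedGroupAlgebra α →ₐ[ℂ] Matrix (Fin d) (Fin d) ℂ) : d ≠ 1 := by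
  rintro rfl
  refine hα ((QuotientGroup.eq_one_iff α).2
    ⟨fun g => Units.map Matrix.detMonoidHom (basisImage ρ g), ?_⟩)
  refine Subtype.ext (funext fun ⟨g, h⟩ => ?_)
  change Units.map Matrix.detMonoidHom (basisImage ρ g) *
    Units.map Matrix.detMonoidHom (basisImage ρ h) *
      (Units.map Matrix.detMonoidHom (basisImage ρ (g * h)))⁻¹ = α.1 (g, h)
  rw [mul_inv_eq_iff_eq_mul, ← map_mul]
  refine Units.ext ?_
  change Matrix.det (basisImage ρ g * basisImage ρ h).val =
    (α.1 (g, h) : ℂ) * Matrix.det (basisImage ρ (g * h)).val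
  rw [basisImage_mul, Matrix.det_smul, Fintype.card_fin, pow_one]

/-- Write `α` as an inflated cocycle times a coboundary. The first factor is symmetric at `(z, g)`
because `z` becomes `1` in `G / Z`, the second because `z` is central. -/
theorem commute_of_mem_range_inflation {Z : Subgroup G} [Z.Normal] (hZ : Z ≤ center G)
    (hα : cohomologyClass α ∈ (inflation ℂˣ Z).range) {z : G} (hz : z ∈ Z) (g : G) :
    α.1 (z, g) = α.1 (g, z) := by
  obtain ⟨b, hb⟩ := hα
  obtain ⟨β, rfl⟩ := QuotientGroup.mk'_surjective _ b
  have hb' : cohomologyClass (inflationCocycle ℂˣ Z β) = cohomologyClass α := hb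
  obtain ⟨u, hu⟩ := QuotientGroup.eq.1 hb'
  have h (x y : G) : α.1 (x, y) = β.1 (x, y) * (u x * u y * (u (x * y))⁻¹) := by
    rw [eq_inv_mul_iff_mul_eq] at hu
    rw [← hu]
    rfl
  have hz1 : (z : G ⧸ Z) = 1 := (QuotientGroup.eq_one_iff z).2 hz
  rw [h, h, hz1, map_one_fst, map_one_snd β g, mem_center_iff.1 (hZ hz) g, mul_comm (u z)]

theorem le_ker_projectiveHom (hρ : Function.Surjective ρ) {Z : Subgroup G} [Z.Normal]
    (hZ : Z ≤ center G) (hα : cohomologyClass α ∈ (inflation ℂˣ Z).range) :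
    Z ≤ (projectiveHom ρ).ker := by
  intro z hz
  obtain ⟨c, hc⟩ : ∃ c : ℂ, (basisImage ρ z).val = c • 1 := by
    refine Matrix.exists_smul_one_of_commute_span (span_basisImage ρ hρ) ?_
    rintro _ ⟨g, rfl⟩
    change (basisImage ρ g * basisImage ρ z).val = (basisImage ρ z * basisImage ρ g).val
    rw [basisImage_mul, basisImage_mul, commute_of_mem_range_inflation hZ hα hz,
      mem_center_iff.1 (hZ hz)]
  exact (QuotientGroup.eq_one_iff _).2 (Matrix.mem_center_units_of_val_eq_smul_one hc)

/-- If the class of `α` is inflated from `G / Z`, an irreducible representation of `ℂ^α G` gives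
a projective representation of `G / Z`. -/
theorem exists_projective_lift_quotient (hρ : Function.Surjective ρ) {Z : Subgroup G} [Z.Normal]
    (hZ : Z ≤ center G) (hα : cohomologyClass α ∈ (inflation ℂˣ Z).range) :
    ∃ (f : G ⧸ Z →* (Matrix (Fin d) (Fin d) ℂ)ˣ ⧸ center (Matrix (Fin d) (Fin d) ℂ)ˣ)
      (r : G ⧸ Z → (Matrix (Fin d) (Fin d) ℂ)ˣ),
      (∀ x, QuotientGroup.mk' (center (Matrix (Fin d) (Fin d) ℂ)ˣ) (r x) = f x) ∧
      Submodule.span ℂ (Set.range fun x => (r x : Matrix (Fin d) (Fin d) ℂ)) = ⊤ := by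
  let f := QuotientGroup.lift Z (projectiveHom ρ) (le_ker_projectiveHom ρ hρ hZ hα)
  have hf (x : G ⧸ Z) : QuotientGroup.mk' (center (Matrix (Fin d) (Fin d) ℂ)ˣ)
      (basisImage ρ x.out) = f x := by
    conv_rhs => rw [← QuotientGroup.out_eq' x]
    rfl
  refine ⟨f, fun x => basisImage ρ x.out, hf, ?_⟩
  rw [eq_top_iff, ← span_basisImage ρ hρ, Submodule.span_le]
  rintro _ ⟨g, rfl⟩
  -- Coset representatives suffice: within a coset the images differ by scalars.
  obtain ⟨c, hc⟩ := Matrix.exists_eq_smul_of_mk_eq (g := basisImage ρ g)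
    (h := basisImage ρ (g : G ⧸ Z).out) (hf g).symm
  dsimp only
  rw [hc]
  exact Submodule.smul_mem _ _ (Submodule.subset_span ⟨_, rfl⟩)

theorem degree_eq_prime {p : ℕ} (hp : p.Prime) (hcard : Nat.card G = p ^ 5) [NeZero d]
    {Z : Subgroup G} [Z.Normal] (hZ : Z ≤ center G) (hZ_ne : Z ≠ ⊥)
    (hct : ¬ IsCentralType (G ⧸ Z)) (hinf : cohomologyClass α ∈ (inflation ℂˣ Z).range)
    (hα : cohomologyClass α ≠ 1) (hρ : Function.Surjective ρ) : d = p := by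
  have : Finite G := Nat.finite_of_card_ne_zero (by rw [hcard]; exact pow_ne_zero _ hp.ne_zero)
  have := Fintype.ofFinite (G ⧸ Z)
  obtain ⟨f, r, hr, hspan⟩ := exists_projective_lift_quotient ρ hρ hZ hinf
  have hmul := card_eq_card_quotient_mul_card_subgroup Z
  rw [hcard, Nat.card_eq_fintype_card (α := G ⧸ Z)] at hmul
  obtain ⟨m, hm, hX⟩ := (Nat.dvd_prime_pow hp).1 (Dvd.intro _ hmul.symm)
  have hm4 : m ≠ 5 := by
    rintro rfl
    rw [hX] at hmul
    have h1 : Nat.card Z = 1 :=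
      (Nat.eq_of_mul_eq_mul_left (pow_pos hp.pos 5) (by rw [mul_one]; exact hmul)).symm
    exact hZ_ne (Subgroup.card_eq_one.1 h1)
  have hdvd := degree_dvd_card_of_span_eq_top f r hr hspan
  rw [hX] at hdvd
  obtain ⟨k, -, rfl⟩ := (Nat.dvd_prime_pow hp).1 hdvd
  have hle := degree_sq_le_card f r hr hspan
  have hne : Fintype.card (G ⧸ Z) ≠ (p ^ k) ^ 2 := fun h =>
    hct (isCentralType_of_card_eq_degree_sq f r hr hspan h)
  rw [hX, ← pow_mul, Nat.pow_le_pow_iff_right hp.one_lt] at hle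
  rw [hX, ← pow_mul] at hne
  have hmk : m ≠ k * 2 := fun h => hne (by rw [h])
  have hk0 : k ≠ 0 := by
    rintro rfl
    exact degree_ne_one hα ρ (pow_zero p)
  -- From `k ≠ 0`, `k * 2 ≤ m`, `m ≠ k * 2` and `m ≤ 4`.
  have : k = 1 := by omega
  rw [this, pow_one]

end TwistedGroupAlgebra

/-! ### The main theorem -/

theorem theorem4p1 {p : ℕ} (hp : p.Prime) {G : Type*} [Group G]
    (hcard : Nat.card G = p ^ 5) (hnonab : ¬ ∀ x y : G, x * y = y * x)
    (Z : Subgroup G) [Z.Normal] (hZ : Z ≤ Subgroup.center G) (hZ_ne : Z ≠ ⊥)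
    (hct : ¬ IsCentralType (G ⧸ Z)) (hquot : p ^ 2 ≤ Nat.card (G ⧸ Z))
    (htra : Function.Injective (transgression ℂˣ Z hZ))
    (hexact : Function.MulExact (transgression ℂˣ Z hZ) (inflation ℂˣ Z))
    (hinf : Function.Surjective (inflation ℂˣ Z))
    (α : TwoCocycle G ℂˣ) (hα : cohomologyClass α ≠ 1) :
    Nonempty (TwistedGroupAlgebra α ≃ₐ[ℂ] (Fin (p ^ 3) → Matrix (Fin p) (Fin p) ℂ)) := by
  have : Finite G := Nat.finite_of_card_ne_zero (by rw [hcard]; exact pow_ne_zero _ hp.ne_zero)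
  have := Fintype.ofFinite G
  obtain ⟨n, d, hd, ⟨e⟩⟩ :=
    IsSemisimpleRing.exists_algEquiv_pi_matrix_of_isAlgClosed ℂ (TwistedGroupAlgebra α)
  -- Each projection onto a factor is a surjective matrix representation, so `degree_eq_prime`
  -- applies blockwise.
  have hdp : d = fun _ => p := funext fun i =>
    TwistedGroupAlgebra.degree_eq_prime
      ((Pi.evalAlgHom ℂ (fun i => Matrix (Fin (d i)) (Fin (d i)) ℂ) i).comp e.toAlgHom)
      hp hcard hZ hZ_ne hct (hinf _) hα
      ((Function.surjective_eval i).comp e.surjective)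
  subst hdp
  have hfin := e.toLinearEquiv.finrank_eq
  rw [TwistedGroupAlgebra.finrank_eq, ← Nat.card_eq_fintype_card, hcard,
    Module.finrank_pi_fintype] at hfin
  simp only [Module.finrank_matrix, Fintype.card_fin, Module.finrank_self, mul_one,
    Finset.sum_const, Finset.card_univ, smul_eq_mul] at hfin
  have hn : n = p ^ 3 := by
    refine Nat.eq_of_mul_eq_mul_right (Nat.mul_pos hp.pos hp.pos) ?_
    rw [← hfin]
    ring
  subst hn
  exact ⟨e⟩
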